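/- **Theorem (synchronization).** Consider $N$ identical linear port-Hamiltonian subsystems $$\dot x_i = A x_i + B v_i,\qquad z_i = C x_i,\qquad A=(J-R)Q,\quad C=B^{\mathsf T}Q,\qquad i=1,\dots,N,$$ with real matrices $J,R,Q\in\mathbb R^{n\times n}$, $B\in\mathbb R^{n\times m}$ such that $J=-J^{\mathsf T}$, $R=R^{\mathsf T}\succcurlyeq 0$ and $Q=Q^{\mathsf T}\succ 0$ (so that the subsystems are passive with storage function $\tfrac12 x_i^{\mathsf T}Qx_i$). Assume that $(A,B,C)$ is a minimal realization, i.e. no realization of the transfer matrix $C(sI-A)^{-1}B$ has state dimension smaller than $n$. The subsystems are interconnected by $$v_i=\sum_{j\ne i} w_{ij}(z_j-z_i)+\sum_{j} g_{ij}u_j,\qquad y_i=\sum_{j}h_{ij}z_j,$$ with weights $w_{ij}\ge 0$ ($i\neq j$) and real matrices $G=(g_{ij})$, $H=(h_{ij})$. Let $L_{ij}=-w_{ij}$ for $i\ne j$ and $L_{ii}=\sum_{j\ne i}w_{ij}$, so that the networked system reads $$\dot x=(I\otimes A-L\otimes BC)x+(G\otimes B)u,\qquad y=(H\otimes C)x,\qquad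 x=(x_1,\dots,x_N).$$ Let $\mathcal G$ be the directed graph on $\{1,\dots,N\}$ with an arc from $i$ to $j\neq i$ if and only if $w_{ji}>0$, and let the underlying undirected graph $\mathcal G_{\mathrm u}$ have an edge between $i\ne j$ if and only if $w_{ij}+w_{ji}>0$. Assume that 1. $\mathcal G_{\mathrm u}$ is a tree; 2. $\mathcal G$ contains as a subgraph a directed rooted spanning tree, i.e. a directed graph on all $N$ vertices that becomes a tree when directions are forgotten and has a root vertex with no incoming arc such that every other vertex has exactly one incoming arc. Then every trajectory of the networked system on $[0,\infty)$ with $u=0$ satisfies $$\lim_{t\to\infty}\bigl(x_i(t)-x_j(t)\bigr)=0\qquad\text{for all } i,j\in\{1,\dots,N\}.$$ -/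

import Mathlib

open scoped Kronecker Matrix Topology

noncomputable section

namespace PHNetwork

/-- The transfer matrix `C (s I - A)⁻¹ B` of the linear system `x' = A x + B v`, `z = C x`,
as a matrix of rational functions in the indeterminate `s`. -/
def transferMatrix {n m p : ℕ} (A : Matrix (Fin n) (Fin n) ℝ) (B : Matrix (Fin n) (Fin m) ℝ)
    (C : Matrix (Fin p) (Fin n) ℝ) : Matrix (Fin p) (Fin m) (RatFunc ℝ) :=
  let c : ℝ →+* RatFunc ℝ := RatFunc.C
  C.map c * ((RatFunc.X : RatFunc ℝ) • (1 : Matrix (Fin n) (Fin n) (RatFunc ℝ)) - A.map c)⁻¹ *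
    B.map c

/-- `(A, B, C)` is a minimal realization: no realization of the same transfer matrix has a
state space of smaller dimension. -/
def IsMinimalRealization {n m p : ℕ} (A : Matrix (Fin n) (Fin n) ℝ)
    (B : Matrix (Fin n) (Fin m) ℝ) (C : Matrix (Fin p) (Fin n) ℝ) : Prop :=
  ∀ (k : ℕ) (A' : Matrix (Fin k) (Fin k) ℝ) (B' : Matrix (Fin k) (Fin m) ℝ)
    (C' : Matrix (Fin p) (Fin k) ℝ),
    transferMatrix A' B' C' = transferMatrix A B C → n ≤ k

/-- A linear port-Hamiltonian system `x' = (J - R) Q x + B v`, `z = Bᵀ Q x`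
with state dimension `n` and `m` inputs and outputs. -/
structure PortHamiltonian (n m : ℕ) where
  J : Matrix (Fin n) (Fin n) ℝ
  R : Matrix (Fin n) (Fin n) ℝ
  Q : Matrix (Fin n) (Fin n) ℝ
  B : Matrix (Fin n) (Fin m) ℝ
  J_skew : Jᵀ = -J
  R_posSemidef : R.PosSemidef
  Q_posDef : Q.PosDef

namespace PortHamiltonian

variable {n m : ℕ} (S : PortHamiltonian n m)

def A : Matrix (Fin n) (Fin n) ℝ := (S.J - S.R) * S.Q

def C : Matrix (Fin m) (Fin n) ℝ := S.Bᵀ * S.Q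

end PortHamiltonian

/-- The matrix `L` of the diffusive coupling with weights `w i j`, `i ≠ j`. -/
def couplingMatrix {N : ℕ} (w : Fin N → Fin N → ℝ) : Matrix (Fin N) (Fin N) ℝ :=
  Matrix.of fun i j => if i = j then ∑ k ∈ Finset.univ.erase i, w i k else -w i j

/-- The directed graph of the coupling: there is an arc from `i` to `j` iff `w j i > 0`. -/
def couplingDigraph {N : ℕ} (w : Fin N → Fin N → ℝ) : Digraph (Fin N) where
  Adj i j := i ≠ j ∧ 0 < w j i

/-- The underlying undirected graph of the coupling. -/
def underlyingGraph {N : ℕ} (w : Fin N → Fin N → ℝ) : SimpleGraph (Fin N) where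
  Adj i j := i ≠ j ∧ 0 < w i j + w j i
  symm := ⟨fun i j h => ⟨h.1.symm, by rw [add_comm]; exact h.2⟩⟩
  loopless := ⟨fun _ h => h.1 rfl⟩

/-- `T` is a directed rooted tree on all of `V`: forgetting directions gives a tree, the root has
no incoming arc, and every other vertex has exactly one incoming arc. -/
def IsDirectedRootedSpanningTree {V : Type*} (T : Digraph V) : Prop :=
  T.toSimpleGraphInclusive.IsTree ∧
    ∃ r : V, (∀ v, ¬ T.Adj v r) ∧ ∀ v, v ≠ r → ∃! u, T.Adj u v

/-- A network of `N` copies of the port-Hamiltonian system `sub`, with nonnegative coupling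
weights `w i j` (`i ≠ j`), input distribution `G` and output distribution `H`. -/
structure NetworkedSystem (N n m q p : ℕ) where
  sub : PortHamiltonian n m
  w : Fin N → Fin N → ℝ
  w_nonneg : ∀ i j, i ≠ j → 0 ≤ w i j
  G : Matrix (Fin N) (Fin q) ℝ
  H : Matrix (Fin p) (Fin N) ℝ

namespace NetworkedSystem

variable {N n m q p : ℕ} (S : NetworkedSystem N n m q p)

/-- `(u, x, y)` is a trajectory of the networked system on `[0, ∞)`:
`x' = (I ⊗ A - L ⊗ B C) x + (G ⊗ B) u` and `y = (H ⊗ C) x`.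
The entry `(i, k)` of `x t` is the `k`-th coordinate of the state of subsystem `i`. -/
def IsTrajectory (u : ℝ → Fin q × Fin m → ℝ) (x : ℝ → Fin N × Fin n → ℝ)
    (y : ℝ → Fin p × Fin m → ℝ) : Prop :=
  ∀ t : ℝ, 0 ≤ t →
    HasDerivWithinAt x
      (((1 : Matrix (Fin N) (Fin N) ℝ) ⊗ₖ S.sub.A - couplingMatrix S.w ⊗ₖ (S.sub.B * S.sub.C)) *ᵥ
          x t + (S.G ⊗ₖ S.sub.B) *ᵥ u t)
      (Set.Ici 0) t ∧
    y t = (S.H ⊗ₖ S.sub.C) *ᵥ x t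

end NetworkedSystem

end PHNetwork

end

open scoped Kronecker Matrix Topology

namespace PHNetwork

/-! Work with the dual: functionals vanishing on synchronized states form a subspace
(`disagreement`) invariant under the adjoint dynamics, so it suffices that every eigenvalue `ν`
there has negative real part. Let `l` be an eigenvector with `Re ν ≥ 0` and `v` a generalized
eigenvector of `L` for `μ`. By induction along the Jordan chain, `v ᵥ* l` is a left eigenvector of
`A - μ BC` for `ν`, or zero. If `μ ≠ 0`, Gershgorin gives `Re μ > 0`; passivity then forces `v ᵥ* l`
to annihilate `B`, and minimality makes it vanish. If `μ = 0`, the root makes `v` a multiple of `1`,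
which `l` kills. These `v` span, so `l = 0`. Neither `L` nor the dynamics need be diagonalizable. -/

/-! ### Decay of solutions from the spectrum. -/

/-- Along a generalized eigenvector, solutions grow at most like a polynomial times `exp (μ t)`. -/
theorem exists_norm_mul_exp_le {V : Type*} [AddCommGroup V] [Module ℂ V]
    (T : Module.End ℂ V) (φ : V →ₗ[ℂ] (ℝ → ℂ))
    (hφ : ∀ v, ∀ t : ℝ, 0 ≤ t → HasDerivWithinAt (φ v) (φ (T v) t) (Set.Ici 0) t)
    (μ : ℂ) (k : ℕ) : ∀ v, ((T - algebraMap ℂ (Module.End ℂ V) μ) ^ k) v = 0 →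
      ∃ c : ℝ, ∀ t : ℝ, 0 ≤ t → ‖φ v t * Complex.exp (-μ * t)‖ ≤ c * (1 + t) ^ k := by
  induction k with
  | zero =>
    intro v hv
    refine ⟨0, fun t _ => ?_⟩
    have hv0 : v = 0 := by simpa using hv
    simp [hv0]
  | succ k ih =>
    intro v hv
    obtain ⟨c, hc⟩ := ih ((T - algebraMap ℂ (Module.End ℂ V) μ) v) (by
      rw [pow_succ] at hv; exact hv)
    have hder : ∀ s : ℝ, 0 ≤ s → HasDerivWithinAt (fun t : ℝ => φ v t * Complex.exp (-μ * t))
        (φ ((T - algebraMap ℂ (Module.End ℂ V) μ) v) s * Complex.exp (-μ * s))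
        (Set.Ici 0) s := by
      intro s hs
      have h1 : HasDerivAt (fun t : ℝ => Complex.exp (-μ * t))
          (Complex.exp (-μ * s) * (-μ * 1)) s :=
        ((Complex.ofRealCLM.hasDerivAt (x := s)).const_mul (-μ)).cexp
      refine ((hφ v s hs).mul h1.hasDerivWithinAt).congr_deriv ?_
      rw [LinearMap.sub_apply, map_sub, Module.algebraMap_end_apply, map_smul, Pi.sub_apply,
        Pi.smul_apply, smul_eq_mul]
      ring
    have hc0 : 0 ≤ c := by simpa using (norm_nonneg _).trans (hc 0 le_rfl)
    -- Mean value inequality on `[0, t]`: the derivative is at most `c * (1 + t) ^ k`, and `t ≤ 1 +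
    -- t` raises the exponent by one.
    refine ⟨‖φ v 0‖ + c, fun t ht => ?_⟩
    have hmv := (convex_Icc (0 : ℝ) t).norm_image_sub_le_of_norm_hasDerivWithin_le
      (f := fun t : ℝ => φ v t * Complex.exp (-μ * t)) (C := c * (1 + t) ^ k)
      (fun s hs => (hder s hs.1).mono Set.Icc_subset_Ici_self)
      (fun s hs => (hc s hs.1).trans (by have := hs.1; have := hs.2; gcongr))
      (Set.left_mem_Icc.2 ht) (Set.right_mem_Icc.2 ht)
    simp only [Complex.ofReal_zero, mul_zero, Complex.exp_zero, mul_one, sub_zero,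
      Real.norm_of_nonneg ht] at hmv
    have h1 : ‖φ v t * Complex.exp (-μ * t)‖ ≤ ‖φ v 0‖ + c * (1 + t) ^ k * t := by
      have := norm_le_norm_add_norm_sub' (φ v t * Complex.exp (-μ * t)) (φ v 0)
      linarith
    have h2 : 1 ≤ (1 + t) ^ (k + 1) := one_le_pow₀ (by linarith)
    have h3 : c * (1 + t) ^ k * t ≤ c * (1 + t) ^ (k + 1) := by
      rw [pow_succ, mul_assoc]; gcongr; linarith
    nlinarith [mul_le_mul_of_nonneg_left h2 (norm_nonneg (φ v 0))]

theorem tendsto_one_add_pow_mul_exp (k : ℕ) {b : ℝ} (hb : b < 0) :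
    Filter.Tendsto (fun t : ℝ => (1 + t) ^ k * Real.exp (b * t)) Filter.atTop (𝓝 0) := by
  -- The factor `exp (-b)` undoes the substitution of `1 + t` for `t` in the exponential.
  have h := ((tendsto_rpow_mul_exp_neg_mul_atTop_nhds_zero k (-b) (neg_pos.2 hb)).comp
    (Filter.tendsto_atTop_add_const_left Filter.atTop (1 : ℝ) Filter.tendsto_id)).const_mul
      (Real.exp (-b))
  rw [mul_zero] at h
  refine h.congr fun t => ?_
  simp only [Function.comp_apply, id, Real.rpow_natCast]
  rw [mul_left_comm, ← Real.exp_add]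
  ring_nf

/-- Generalized eigenvectors span, and on each the exponential beats the polynomial. Leaving `φ`
abstract lets it be evaluation of functionals along one given trajectory. -/
theorem tendsto_zero_of_eigenvalues_re_neg {V : Type*} [AddCommGroup V] [Module ℂ V]
    [FiniteDimensional ℂ V] (T : Module.End ℂ V) (hT : ∀ μ, T.HasEigenvalue μ → μ.re < 0)
    (φ : V →ₗ[ℂ] (ℝ → ℂ))
    (hφ : ∀ v, ∀ t : ℝ, 0 ≤ t → HasDerivWithinAt (φ v) (φ (T v) t) (Set.Ici 0) t) (v : V) :
    Filter.Tendsto (φ v) Filter.atTop (𝓝 0) := by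
  have hv : v ∈ ⨆ μ : ℂ, T.maxGenEigenspace μ := by
    rw [Module.End.iSup_maxGenEigenspace_eq_top]; trivial
  induction hv using Submodule.iSup_induction' with
  | zero => rw [map_zero]; exact tendsto_const_nhds
  | add x y _ _ hx hy => rw [map_add, ← add_zero (0 : ℂ)]; exact hx.add hy
  | mem μ x hx =>
    obtain rfl | hx0 := eq_or_ne x 0
    · rw [map_zero]; exact tendsto_const_nhds
    have hμ : μ.re < 0 := by
      apply hT
      have : T.HasUnifEigenvalue μ ⊤ := fun h => hx0 (by
        rw [Module.End.maxGenEigenspace, h] at hx; simpa using hx)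
      exact this.lt zero_lt_one
    obtain ⟨k, hk⟩ := (Module.End.mem_maxGenEigenspace T μ x).1 hx
    obtain ⟨c, hc⟩ := exists_norm_mul_exp_le T φ hφ μ k x hk
    have h0 := (tendsto_one_add_pow_mul_exp k hμ).const_mul c
    rw [mul_zero] at h0
    refine squeeze_zero_norm' ?_ h0
    filter_upwards [Filter.eventually_ge_atTop 0] with t ht
    have h1 : φ x t = φ x t * Complex.exp (-μ * t) * Complex.exp (μ * t) := by
      rw [mul_assoc, ← Complex.exp_add]; simp
    rw [h1, norm_mul, Complex.norm_exp, ← mul_assoc]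
    have h2 : (μ * t).re = μ.re * t := by simp
    rw [h2]
    exact mul_le_mul_of_nonneg_right (hc t ht) (Real.exp_pos _).le

/-! ### Minimality and controllability. -/

/-- The realization may be restricted along a map intertwining the state matrices. -/
theorem transferMatrix_eq_of_intertwine {n m p k : ℕ} (A : Matrix (Fin n) (Fin n) ℝ)
    (B : Matrix (Fin n) (Fin m) ℝ) (C : Matrix (Fin p) (Fin n) ℝ)
    (A' : Matrix (Fin k) (Fin k) ℝ) (B' : Matrix (Fin k) (Fin m) ℝ)
    (P : Matrix (Fin n) (Fin k) ℝ) (hA : A * P = P * A') (hB : B = P * B') :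
    transferMatrix A' B' (C * P) = transferMatrix A B C := by
  have hdet : ∀ {k : ℕ} (M : Matrix (Fin k) (Fin k) ℝ),
      IsUnit ((RatFunc.X : RatFunc ℝ) • (1 : Matrix (Fin k) (Fin k) (RatFunc ℝ)) -
        M.map (RatFunc.C : ℝ →+* RatFunc ℝ)).det := by
    intro k M
    have h : (RatFunc.X : RatFunc ℝ) • (1 : Matrix (Fin k) (Fin k) (RatFunc ℝ)) -
        M.map (RatFunc.C : ℝ →+* RatFunc ℝ) =
        M.charmatrix.map (algebraMap (Polynomial ℝ) (RatFunc ℝ)) := by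
      ext i j
      by_cases hij : i = j <;> simp [hij, Matrix.charmatrix]
    rw [h, ← RingHom.mapMatrix_apply, ← RingHom.map_det, isUnit_iff_ne_zero]
    exact (map_ne_zero_iff _ (RatFunc.algebraMap_injective ℝ)).2 M.charpoly_monic.ne_zero
  simp only [transferMatrix]
  set c : ℝ →+* RatFunc ℝ := RatFunc.C
  have h1 := hdet A
  have h2 := hdet A'
  set X1 := (RatFunc.X : RatFunc ℝ) • (1 : Matrix (Fin n) (Fin n) (RatFunc ℝ)) - A.map c
  set X2 := (RatFunc.X : RatFunc ℝ) • (1 : Matrix (Fin k) (Fin k) (RatFunc ℝ)) - A'.map c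
  have h3 : X1 * P.map c = P.map c * X2 := by
    have := congrArg (fun M => M.map c) hA
    simp only [Matrix.map_mul] at this
    simp [X1, X2, Matrix.sub_mul, Matrix.mul_sub, this]
  have h4 : P.map c * X2⁻¹ = X1⁻¹ * P.map c := by
    calc P.map c * X2⁻¹ = X1⁻¹ * (X1 * P.map c) * X2⁻¹ := by
          rw [← Matrix.mul_assoc, Matrix.nonsing_inv_mul _ h1, Matrix.one_mul]
      _ = X1⁻¹ * P.map c := by
          rw [h3, Matrix.mul_assoc, Matrix.mul_assoc, Matrix.mul_nonsing_inv _ h2, Matrix.mul_one]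
  rw [hB, Matrix.map_mul, Matrix.map_mul, Matrix.mul_assoc _ (P.map c), h4]
  simp only [Matrix.mul_assoc]

/-- A minimal realization passes the Popov–Belevitch–Hautus controllability test. -/
theorem IsMinimalRealization.eq_zero_of_vecMul {n m p : ℕ} {A : Matrix (Fin n) (Fin n) ℝ}
    {B : Matrix (Fin n) (Fin m) ℝ} {C : Matrix (Fin p) (Fin n) ℝ}
    (hmin : IsMinimalRealization A B C) {r : Fin n → ℂ} {μ : ℂ}
    (hA : r ᵥ* A.map Complex.ofReal = μ • r) (hB : r ᵥ* B.map Complex.ofReal = 0) : r = 0 := by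
  -- The real kernel of `r` is `A`-invariant and contains the range of `B`, so the system restricts
  -- to it with the same transfer matrix; minimality makes it the whole space.
  let f : (Fin n → ℝ) →ₗ[ℝ] ℂ :=
    { toFun := fun x => r ⬝ᵥ (fun i => (x i : ℂ))
      map_add' := fun x y => by simp [dotProduct, mul_add, Finset.sum_add_distrib]
      map_smul' := fun a x => by
        simp [dotProduct, Finset.mul_sum, mul_left_comm] }
  have hf : ∀ {k : ℕ} (M : Matrix (Fin n) (Fin k) ℝ) (x : Fin k → ℝ),
      f (M *ᵥ x) = (r ᵥ* M.map Complex.ofReal) ⬝ᵥ (fun i => (x i : ℂ)) := by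
    intro k M x
    rw [← Matrix.dotProduct_mulVec]
    simp only [f, LinearMap.coe_mk, AddHom.coe_mk]
    congr 1
    ext i
    simp [Matrix.mulVec, dotProduct]
  let W := LinearMap.ker f
  have hAW : ∀ x ∈ W, Matrix.toLin' A x ∈ W := by
    intro x hx
    rw [LinearMap.mem_ker] at hx ⊢
    rw [Matrix.toLin'_apply, hf, hA, smul_dotProduct]
    change μ • f x = 0
    rw [hx, smul_zero]
  have hBW : ∀ x, Matrix.toLin' B x ∈ W := by
    intro x
    rw [LinearMap.mem_ker, Matrix.toLin'_apply, hf, hB, zero_dotProduct]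
  let b := Module.finBasis ℝ W
  let e := b.equivFun
  let P : Matrix (Fin n) (Fin (Module.finrank ℝ W)) ℝ :=
    LinearMap.toMatrix' (W.subtype ∘ₗ e.symm.toLinearMap)
  let A' : Matrix (Fin (Module.finrank ℝ W)) (Fin (Module.finrank ℝ W)) ℝ :=
    LinearMap.toMatrix' (e.toLinearMap ∘ₗ (Matrix.toLin' A).restrict hAW ∘ₗ e.symm.toLinearMap)
  let B' : Matrix (Fin (Module.finrank ℝ W)) (Fin m) ℝ :=
    LinearMap.toMatrix' (e.toLinearMap ∘ₗ (Matrix.toLin' B).codRestrict W hBW)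
  have h1 : A * P = P * A' := by
    apply Matrix.toLin'.injective
    rw [Matrix.toLin'_mul, Matrix.toLin'_mul]
    ext x
    simp [P, A']
  have h2 : B = P * B' := by
    apply Matrix.toLin'.injective
    rw [Matrix.toLin'_mul]
    ext x
    simp [P, B']
  have hle := hmin _ A' B' (C * P) (transferMatrix_eq_of_intertwine A B C A' B' P h1 h2)
  have hW : W = ⊤ := by
    apply Submodule.eq_top_of_finrank_eq
    exact le_antisymm (Submodule.finrank_le W) (by simpa using hle)
  funext i
  have : f (Pi.single i 1) = 0 := by
    rw [← LinearMap.mem_ker]; change _ ∈ W; rw [hW]; trivial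
  simpa [f, dotProduct, Pi.single_apply, apply_ite Complex.ofReal] using this

/-! ### Rooted graphs and the spectrum of the coupling matrix. -/

theorem IsDirectedRootedSpanningTree.exists_root {V : Type*} {T : Digraph V}
    (hT : IsDirectedRootedSpanningTree T) : ∃ r, ∀ v, Relation.ReflTransGen T.Adj r v := by
  obtain ⟨htree, r, hr, huniq⟩ := hT
  refine ⟨r, fun v => ?_⟩
  have key : ∀ a b, T.toSimpleGraphInclusive.Adj a b → Relation.ReflTransGen T.Adj r a →
      Relation.ReflTransGen T.Adj r b := by
    rintro a b ⟨-, hab | hba⟩ ha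
    · exact ha.tail hab
    -- The edge is crossed backwards: `b` is the unique parent of `a`, so the path to `a` already
    -- passed through `b`.
    · obtain rfl | ⟨c, hc, hca⟩ := ha.cases_tail
      · exact absurd hba (hr _)
      · have har : a ≠ r := fun h => hr c (h ▸ hca)
        rwa [(huniq a har).unique hba hca]
  have hreach := (SimpleGraph.reachable_iff_reflTransGen r v).1
    (htree.connected.preconnected r v)
  induction hreach with
  | refl => exact .refl
  | tail _ h ih => exact key _ _ h ih

theorem couplingMatrix_mulVec {N : ℕ} (w : Fin N → Fin N → ℝ) (v : Fin N → ℝ) (i : Fin N) :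
    (couplingMatrix w *ᵥ v) i = ∑ j ∈ Finset.univ.erase i, w i j * (v i - v j) := by
  rw [Matrix.mulVec, dotProduct, ← Finset.add_sum_erase _ _ (Finset.mem_univ i)]
  simp only [mul_sub, Finset.sum_sub_distrib, ← Finset.sum_mul]
  rw [sub_eq_add_neg, ← Finset.sum_neg_distrib]
  congr 1
  · simp [couplingMatrix]
  · refine Finset.sum_congr rfl fun j hj => ?_
    simp [couplingMatrix, (Finset.ne_of_mem_erase hj).symm]

/-- Maximum principle: where `v` is maximal, all terms of the row sum are nonnegative, hence zero,
so the maximum spreads to every in-neighbour and finally back to the root. -/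
theorem le_root_of_couplingMatrix_mulVec_nonpos {N : ℕ} {w : Fin N → Fin N → ℝ}
    (hw : ∀ i j, i ≠ j → 0 ≤ w i j) {r : Fin N}
    (hr : ∀ i, Relation.ReflTransGen (couplingDigraph w).Adj r i)
    {v : Fin N → ℝ} (hv : ∀ i, (couplingMatrix w *ᵥ v) i ≤ 0) (i : Fin N) : v i ≤ v r := by
  have : Nonempty (Fin N) := ⟨r⟩
  obtain ⟨a, ha⟩ := Finite.exists_max v
  suffices h : v r = v a from h ▸ ha i
  have hra := hr a
  clear hr
  induction hra using Relation.ReflTransGen.head_induction_on with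
  | refl => rfl
  | @head b c hbc _ ih =>
    have hterm : ∀ j ∈ Finset.univ.erase c, 0 ≤ w c j * (v c - v j) := fun j hj =>
      mul_nonneg (hw c j (Finset.ne_of_mem_erase hj).symm) (by rw [ih]; exact sub_nonneg.2 (ha j))
    have hsum := hv c
    rw [couplingMatrix_mulVec] at hsum
    have h0 := (Finset.sum_eq_zero_iff_of_nonneg hterm).1
      (le_antisymm hsum (Finset.sum_nonneg hterm)) b
      (Finset.mem_erase.2 ⟨hbc.1, Finset.mem_univ _⟩)
    have := (mul_eq_zero.1 h0).resolve_left hbc.2.ne'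
    linarith

/-- Allowing a constant `c` rather than only `0` is what rules out a Jordan block at the eigenvalue
`0`. The maximum principle for `v` and `-v` gives `c = 0` and both inequalities. -/
theorem eq_root_of_couplingMatrix_mulVec_eq_const {N : ℕ} {w : Fin N → Fin N → ℝ}
    (hw : ∀ i j, i ≠ j → 0 ≤ w i j) {r : Fin N}
    (hr : ∀ i, Relation.ReflTransGen (couplingDigraph w).Adj r i)
    {v : Fin N → ℝ} {c : ℝ} (hv : ∀ i, (couplingMatrix w *ᵥ v) i = c) (i : Fin N) :
    v i = v r := by
  have key : ∀ (v : Fin N → ℝ) (c : ℝ), c ≤ 0 → (∀ i, (couplingMatrix w *ᵥ v) i = c) →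
      c = 0 ∧ ∀ i, v i ≤ v r := by
    intro v c hc hv
    have hle := le_root_of_couplingMatrix_mulVec_nonpos hw hr (fun i => (hv i).trans_le hc)
    refine ⟨le_antisymm hc ?_, hle⟩
    rw [← hv r, couplingMatrix_mulVec]
    exact Finset.sum_nonneg fun j hj =>
      mul_nonneg (hw r j (Finset.ne_of_mem_erase hj).symm) (sub_nonneg.2 (hle j))
  have hneg : ∀ i, (couplingMatrix w *ᵥ (-v)) i = -c := fun i => by
    rw [Matrix.mulVec_neg, Pi.neg_apply, hv i]
  have hc : c = 0 := by
    obtain hc | hc := le_total c 0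
    · exact (key v c hc hv).1
    · exact neg_eq_zero.1 (key (-v) (-c) (neg_nonpos.2 hc) hneg).1
  have h1 := (key v c hc.le hv).2 i
  have h2 := (key (-v) (-c) (by simp [hc]) hneg).2 i
  simp only [Pi.neg_apply] at h2
  linarith

theorem re_map_ofReal_mulVec {ι κ : Type*} [Fintype κ] (M : Matrix ι κ ℝ) (v : κ → ℂ) (i : ι) :
    ((M.map Complex.ofReal *ᵥ v) i).re = (M *ᵥ fun j => (v j).re) i := by
  simp [Matrix.mulVec, dotProduct]

theorem im_map_ofReal_mulVec {ι κ : Type*} [Fintype κ] (M : Matrix ι κ ℝ) (v : κ → ℂ) (i : ι) :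
    ((M.map Complex.ofReal *ᵥ v) i).im = (M *ᵥ fun j => (v j).im) i := by
  simp [Matrix.mulVec, dotProduct]

theorem eq_root_of_toLin_couplingMatrix_pow_eq_zero {N : ℕ} {w : Fin N → Fin N → ℝ}
    (hw : ∀ i j, i ≠ j → 0 ≤ w i j) {r : Fin N}
    (hr : ∀ i, Relation.ReflTransGen (couplingDigraph w).Adj r i) (k : ℕ) :
    ∀ v : Fin N → ℂ, (Matrix.toLin' ((couplingMatrix w).map Complex.ofReal) ^ k) v = 0 →
      ∀ i, v i = v r := by
  induction k with
  | zero => intro v hv i; rw [show v = 0 by simpa using hv]; rfl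
  | succ k ih =>
    intro v hv i
    rw [pow_succ] at hv
    have h := ih _ hv
    simp only [Matrix.toLin'_apply] at h
    apply Complex.ext
    · exact eq_root_of_couplingMatrix_mulVec_eq_const hw hr (v := fun j => (v j).re)
        (fun i => by rw [← re_map_ofReal_mulVec, h i]) i
    · exact eq_root_of_couplingMatrix_mulVec_eq_const hw hr (v := fun j => (v j).im)
        (fun i => by rw [← im_map_ofReal_mulVec, h i]) i

/-- By Gershgorin's theorem, the nonzero eigenvalues of a coupling matrix lie in the open right
half-plane. -/
theorem re_pos_of_hasEigenvalue_couplingMatrix {N : ℕ} {w : Fin N → Fin N → ℝ}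
    (hw : ∀ i j, i ≠ j → 0 ≤ w i j) {μ : ℂ}
    (hμ : Module.End.HasEigenvalue (Matrix.toLin' ((couplingMatrix w).map Complex.ofReal)) μ) (h0 : μ ≠ 0) :
    0 < μ.re := by
  obtain ⟨i, hi⟩ := eigenvalue_mem_ball hμ
  set d : ℝ := ∑ j ∈ Finset.univ.erase i, w i j
  have hd : ∑ j ∈ Finset.univ.erase i, ‖(couplingMatrix w).map Complex.ofReal i j‖ = d := by
    refine Finset.sum_congr rfl fun j hj => ?_
    have hij := (Finset.ne_of_mem_erase hj).symm
    simp [couplingMatrix, hij, abs_of_nonneg (hw i j hij)]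
  have hii : (couplingMatrix w).map Complex.ofReal i i = (d : ℂ) := by
    simp [couplingMatrix, d]
  have hd0 : 0 ≤ d := Finset.sum_nonneg fun j hj => hw i j (Finset.ne_of_mem_erase hj).symm
  rw [hd, hii, Metric.mem_closedBall, dist_eq_norm] at hi
  have h1 : Complex.normSq (μ - d) ≤ d ^ 2 := by
    rw [Complex.normSq_eq_norm_sq]; gcongr
  have h2 : 0 < Complex.normSq μ := Complex.normSq_pos.2 h0
  simp only [Complex.normSq_apply, Complex.sub_re, Complex.sub_im, Complex.ofReal_re,
    Complex.ofReal_im, sub_zero] at h1 h2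
  -- The disc `|μ - d| ≤ d` gives `|μ|² ≤ 2 d Re μ`.
  by_contra! hneg
  nlinarith [mul_nonneg hd0 (neg_nonneg.2 hneg)]

/-! ### Passivity and output feedback. -/

theorem vecMul_mul_transpose_dotProduct_star {ι κ : Type*} [Fintype ι] [Fintype κ]
    (K : Matrix ι κ ℝ) (r : ι → ℂ) :
    (r ᵥ* (K * Kᵀ).map Complex.ofReal) ⬝ᵥ star r =
      ((∑ j, Complex.normSq ((r ᵥ* K.map Complex.ofReal) j) : ℝ) : ℂ) := by
  have h : (K * Kᵀ).map Complex.ofReal = K.map Complex.ofReal * (K.map Complex.ofReal)ᴴ := by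
    ext i j
    simp [Matrix.mul_apply]
  rw [h, ← Matrix.vecMul_vecMul, ← Matrix.dotProduct_mulVec, ← Matrix.star_vecMul]
  simp [dotProduct, Complex.mul_conj]

theorem exists_eq_mul_transpose {n : ℕ} {M : Matrix (Fin n) (Fin n) ℝ} (hM : M.PosSemidef) :
    ∃ K : Matrix (Fin n) (Fin n) ℝ, M = K * Kᵀ := by
  open scoped MatrixOrder in
  obtain ⟨K, hK⟩ := CStarAlgebra.nonneg_iff_eq_mul_star_self.1 hM.nonneg
  exact ⟨K, by simpa [Matrix.star_eq_conjTranspose] using hK⟩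

theorem re_vecMul_dotProduct_star_of_transpose_eq_neg {ι : Type*} [Fintype ι]
    {J : Matrix ι ι ℝ} (hJ : Jᵀ = -J) (r : ι → ℂ) :
    ((r ᵥ* J.map Complex.ofReal) ⬝ᵥ star r).re = 0 := by
  have h : (J.map Complex.ofReal)ᴴ = -J.map Complex.ofReal := by
    ext i j
    have := congrFun (congrFun hJ i) j
    simp only [Matrix.transpose_apply, Matrix.neg_apply] at this
    simp [this]
  have h1 : star ((r ᵥ* J.map Complex.ofReal) ⬝ᵥ star r) =
      -((r ᵥ* J.map Complex.ofReal) ⬝ᵥ star r) := by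
    rw [← Matrix.dotProduct_star, Matrix.star_vecMul, h, Matrix.neg_mulVec, dotProduct_neg, Matrix.dotProduct_mulVec]
  have h2 := congrArg Complex.re h1
  simp at h2
  linarith

/-- The closed loop with a static output feedback of gain `μ`, `Re μ > 0`, is stable if the
subsystem is controllable. -/
theorem PortHamiltonian.eq_zero_of_vecMul_feedback {n m : ℕ} (S : PortHamiltonian n m)
    (hctrb : ∀ (r : Fin n → ℂ) (μ : ℂ), r ᵥ* S.A.map Complex.ofReal = μ • r →
      r ᵥ* S.B.map Complex.ofReal = 0 → r = 0)
    {r : Fin n → ℂ} {μ ν : ℂ} (hμ : 0 < μ.re) (hν : 0 ≤ ν.re)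
    (h : r ᵥ* S.A.map Complex.ofReal - μ • r ᵥ* (S.B * S.C).map Complex.ofReal = ν • r) :
    r = 0 := by
  obtain ⟨K, hK⟩ := exists_eq_mul_transpose S.R_posSemidef
  obtain ⟨P, hP⟩ := exists_eq_mul_transpose S.Q_posDef.inv.posSemidef
  have hQ : S.Q * S.Q⁻¹ = 1 :=
    Matrix.mul_nonsing_inv _ ((Matrix.isUnit_iff_isUnit_det _).1 S.Q_posDef.isUnit)
  have hmul : ∀ {a b c : ℕ} (X : Matrix (Fin a) (Fin b) ℝ) (Y : Matrix (Fin b) (Fin c) ℝ),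
      X.map Complex.ofReal * Y.map Complex.ofReal = (X * Y).map Complex.ofReal := fun X Y =>
    (Matrix.map_mul (f := Complex.ofRealHom)).symm
  -- Multiplying by `Q⁻¹` and pairing with `r` leaves, in real parts, `-|rK|² - Re μ |rB|² = Re ν
  -- |rP|²`, where `R = K Kᵀ` and `Q⁻¹ = P Pᵀ`; hence `rB = 0`.
  have h1 := congrArg (fun y => (y ᵥ* S.Q⁻¹.map Complex.ofReal) ⬝ᵥ star r) h
  simp only [Matrix.sub_vecMul, Matrix.smul_vecMul, Matrix.vecMul_vecMul, hmul,
    PortHamiltonian.A, PortHamiltonian.C, Matrix.mul_assoc, hQ, Matrix.mul_one] at h1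
  have hJR : (S.J - S.R).map Complex.ofReal = S.J.map Complex.ofReal - S.R.map Complex.ofReal := by
    ext i j; simp
  rw [hJR, Matrix.vecMul_sub, sub_dotProduct, sub_dotProduct, smul_dotProduct, smul_dotProduct,
    hK, hP, vecMul_mul_transpose_dotProduct_star, vecMul_mul_transpose_dotProduct_star,
    vecMul_mul_transpose_dotProduct_star] at h1
  have h2 := congrArg Complex.re h1
  simp only [Complex.sub_re, smul_eq_mul, Complex.re_mul_ofReal,
    re_vecMul_dotProduct_star_of_transpose_eq_neg S.J_skew, Complex.ofReal_re] at h2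
  have hnn : ∀ {k : ℕ} (y : Fin k → ℂ), 0 ≤ ∑ j, Complex.normSq (y j) := fun y =>
    Finset.sum_nonneg fun j _ => Complex.normSq_nonneg _
  have h3 : ∑ j, Complex.normSq ((r ᵥ* S.B.map Complex.ofReal) j) = 0 := by
    refine le_antisymm ?_ (hnn _)
    have ha := hnn (r ᵥ* K.map Complex.ofReal)
    have hb := mul_nonneg hν (hnn (r ᵥ* P.map Complex.ofReal))
    by_contra! hpos
    have := mul_pos hμ hpos
    linarith
  have hB : r ᵥ* S.B.map Complex.ofReal = 0 := by
    funext j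
    exact Complex.normSq_eq_zero.1
      ((Finset.sum_eq_zero_iff_of_nonneg fun j _ => Complex.normSq_nonneg _).1 h3 j
        (Finset.mem_univ j))
  refine hctrb r ν ?_ hB
  rw [← h, ← hmul, ← Matrix.vecMul_vecMul, hB, Matrix.zero_vecMul, smul_zero, sub_zero]

/-! ### Adjoint dynamics on disagreement functionals. -/

/-- The adjoint `ℓ ↦ ℓ A - Lᵀ ℓ K` of `I ⊗ A - L ⊗ K`, with vectors arranged as matrices. -/
def adjointDynamics {N n : ℕ} (L : Matrix (Fin N) (Fin N) ℂ) (A K : Matrix (Fin n) (Fin n) ℂ) :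
    Module.End ℂ (Matrix (Fin N) (Fin n) ℂ) where
  toFun l := l * A - Lᵀ * l * K
  map_add' l l' := by simp only [Matrix.add_mul, Matrix.mul_add]; abel
  map_smul' c l := by simp [smul_sub]

/-- The functionals that vanish on synchronized states. -/
def disagreement (N n : ℕ) : Submodule ℂ (Matrix (Fin N) (Fin n) ℂ) where
  carrier := {l | 1 ᵥ* l = 0}
  add_mem' {a b} ha hb := by
    rw [Set.mem_ofPred_eq] at *
    rw [Matrix.vecMul_add, ha, hb, add_zero]
  zero_mem' := Matrix.vecMul_zero _
  smul_mem' c a ha := by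
    rw [Set.mem_ofPred_eq] at *
    rw [Matrix.vecMul_smul, ha, smul_zero]

theorem mem_disagreement {N n : ℕ} {l : Matrix (Fin N) (Fin n) ℂ} :
    l ∈ disagreement N n ↔ 1 ᵥ* l = 0 := Iff.rfl

theorem adjointDynamics_mem_disagreement {N n : ℕ} {L : Matrix (Fin N) (Fin N) ℂ}
    (hL : L *ᵥ 1 = 0) (A K : Matrix (Fin n) (Fin n) ℂ) (l : Matrix (Fin N) (Fin n) ℂ)
    (hl : l ∈ disagreement N n) : adjointDynamics L A K l ∈ disagreement N n := by
  rw [mem_disagreement] at *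
  change 1 ᵥ* (l * A - Lᵀ * l * K) = 0
  rw [Matrix.vecMul_sub, ← Matrix.vecMul_vecMul, hl, Matrix.mul_assoc, ← Matrix.vecMul_vecMul,
    Matrix.vecMul_transpose, hL]
  simp

theorem couplingMatrix_map_mulVec_one {N : ℕ} (w : Fin N → Fin N → ℝ) :
    (couplingMatrix w).map Complex.ofReal *ᵥ 1 = 0 := by
  funext i
  apply Complex.ext
  · rw [re_map_ofReal_mulVec, couplingMatrix_mulVec]; simp
  · rw [im_map_ofReal_mulVec, couplingMatrix_mulVec]; simp

theorem re_neg_of_adjointDynamics_eq_smul {N n m : ℕ} (S : PortHamiltonian n m)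
    (hctrb : ∀ (r : Fin n → ℂ) (μ : ℂ), r ᵥ* S.A.map Complex.ofReal = μ • r →
      r ᵥ* S.B.map Complex.ofReal = 0 → r = 0)
    {w : Fin N → Fin N → ℝ} (hw : ∀ i j, i ≠ j → 0 ≤ w i j) {r : Fin N}
    (hr : ∀ i, Relation.ReflTransGen (couplingDigraph w).Adj r i) {ν : ℂ}
    {l : Matrix (Fin N) (Fin n) ℂ} (hl : l ∈ disagreement N n) (hl0 : l ≠ 0)
    (h : adjointDynamics ((couplingMatrix w).map Complex.ofReal) (S.A.map Complex.ofReal)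
      ((S.B * S.C).map Complex.ofReal) l = ν • l) : ν.re < 0 := by
  by_contra! hν
  apply hl0
  set L := (couplingMatrix w).map Complex.ofReal
  set A := S.A.map Complex.ofReal
  set K := (S.B * S.C).map Complex.ofReal with hK
  replace h : l * A - Lᵀ * l * K = ν • l := h
  have hmul : ∀ v : Fin N → ℂ, (v ᵥ* l) ᵥ* A - ((L *ᵥ v) ᵥ* l) ᵥ* K = ν • v ᵥ* l := by
    intro v
    have := congrArg (fun M => v ᵥ* M) h
    simpa only [Matrix.vecMul_sub, Matrix.vecMul_smul, ← Matrix.vecMul_vecMul,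
      Matrix.vecMul_transpose] using this
  have hstep : ∀ (μ : ℂ), 0 < μ.re → ∀ (k : ℕ) (v : Fin N → ℂ),
      ((Matrix.toLin' L - algebraMap ℂ (Module.End ℂ (Fin N → ℂ)) μ) ^ k) v = 0 →
      v ᵥ* l = 0 := by
    intro μ hμ k
    induction k with
    | zero => intro v hv; rw [show v = 0 by simpa using hv, Matrix.zero_vecMul]
    | succ k ih =>
      intro v hv
      rw [pow_succ] at hv
      -- The induction hypothesis kills `(L - μ) v`, so `L` acts on `v` as `μ` once multiplied by
      -- `l`.
      have h1 := ih _ hv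
      rw [LinearMap.sub_apply, Module.algebraMap_end_apply, Matrix.toLin'_apply,
        Matrix.sub_vecMul, Matrix.smul_vecMul, sub_eq_zero] at h1
      have h2 := hmul v
      rw [h1, Matrix.smul_vecMul] at h2
      exact S.eq_zero_of_vecMul_feedback hctrb hμ hν h2
  have hall : ∀ v : Fin N → ℂ, v ᵥ* l = 0 := by
    intro v
    have hv : v ∈ ⨆ μ : ℂ, Module.End.maxGenEigenspace (Matrix.toLin' L) μ := by
      rw [Module.End.iSup_maxGenEigenspace_eq_top]; trivial
    induction hv using Submodule.iSup_induction' with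
    | zero => exact Matrix.zero_vecMul _
    | add x y _ _ hx hy => rw [Matrix.add_vecMul, hx, hy, add_zero]
    | mem μ x hx =>
      obtain ⟨k, hk⟩ := (Module.End.mem_maxGenEigenspace _ μ x).1 hx
      obtain rfl | hx0 := eq_or_ne x 0
      · exact Matrix.zero_vecMul _
      obtain rfl | hμ0 := eq_or_ne μ 0
      · rw [zero_smul, sub_zero] at hk
        have hc := eq_root_of_toLin_couplingMatrix_pow_eq_zero hw hr k x hk
        have hx1 : x = x r • (1 : Fin N → ℂ) := by funext i; simp [hc i]
        rw [hx1, Matrix.smul_vecMul, mem_disagreement.1 hl, smul_zero]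
      · have hμ : Module.End.HasUnifEigenvalue (Matrix.toLin' L) μ ⊤ := fun h => hx0 (by
          rw [Module.End.maxGenEigenspace, h] at hx; simpa using hx)
        exact hstep μ (re_pos_of_hasEigenvalue_couplingMatrix hw (hμ.lt zero_lt_one) hμ0) k x hk
  ext i j
  simpa using congrFun (hall (Pi.single i 1)) j

/-! ### Functionals along trajectories and conclusion. -/

/-- The value at time `t` of the functional `l` along the curve `x`. -/
def observe {N n : ℕ} (x : ℝ → Fin N × Fin n → ℝ) :
    Matrix (Fin N) (Fin n) ℂ →ₗ[ℂ] (ℝ → ℂ) where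
  toFun l t := ∑ p, l p.1 p.2 * (x t p : ℂ)
  map_add' l l' := by funext t; simp [add_mul, Finset.sum_add_distrib]
  map_smul' c l := by funext t; simp [Finset.mul_sum, mul_assoc]

theorem observe_apply {N n : ℕ} (x : ℝ → Fin N × Fin n → ℝ) (l : Matrix (Fin N) (Fin n) ℂ)
    (t : ℝ) : observe x l t = ∑ p, l p.1 p.2 * (x t p : ℂ) := rfl

theorem observe_adjointDynamics {N n : ℕ} (L : Matrix (Fin N) (Fin N) ℝ)
    (A K : Matrix (Fin n) (Fin n) ℝ) (l : Matrix (Fin N) (Fin n) ℂ)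
    (x : ℝ → Fin N × Fin n → ℝ) (t : ℝ) :
    observe x (adjointDynamics (L.map Complex.ofReal) (A.map Complex.ofReal)
      (K.map Complex.ofReal) l) t =
      ∑ p, l p.1 p.2 *
        ((((1 : Matrix (Fin N) (Fin N) ℝ) ⊗ₖ A - L ⊗ₖ K) *ᵥ x t) p : ℂ) := by
  have hkron : ∀ (P : Matrix (Fin N) (Fin N) ℝ) (M : Matrix (Fin n) (Fin n) ℝ),
      ∑ p, l p.1 p.2 * (((P ⊗ₖ M) *ᵥ x t) p : ℂ) =
      ∑ p : Fin N × Fin n,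
        ((P.map Complex.ofReal)ᵀ * l * M.map Complex.ofReal) p.1 p.2 * (x t p : ℂ) := by
    intro P M
    simp only [Matrix.mulVec, dotProduct, Complex.ofReal_sum, Finset.mul_sum]
    rw [Finset.sum_comm]
    refine Finset.sum_congr rfl fun p _ => ?_
    rw [Fintype.sum_prod_type, Finset.sum_comm]
    simp only [Matrix.mul_apply, Finset.sum_mul]
    refine Finset.sum_congr rfl fun k _ => Finset.sum_congr rfl fun i _ => ?_
    simp
    ring
  have h1 := hkron 1 A
  have h2 := hkron L K
  rw [Matrix.map_one _ Complex.ofReal_zero Complex.ofReal_one, Matrix.transpose_one,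
    Matrix.one_mul] at h1
  simp only [Matrix.sub_mulVec, Pi.sub_apply, Complex.ofReal_sub, mul_sub,
    Finset.sum_sub_distrib, h1, h2]
  rw [← Finset.sum_sub_distrib, observe_apply]
  refine Finset.sum_congr rfl fun p _ => ?_
  rw [← sub_mul]
  rfl

theorem NetworkedSystem.IsTrajectory.hasDerivWithinAt_observe {N n m q p : ℕ}
    {S : NetworkedSystem N n m q p} {x : ℝ → Fin N × Fin n → ℝ} {y : ℝ → Fin p × Fin m → ℝ}
    (hx : S.IsTrajectory 0 x y) (l : Matrix (Fin N) (Fin n) ℂ) (t : ℝ) (ht : 0 ≤ t) :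
    HasDerivWithinAt (observe x l)
      (observe x (adjointDynamics ((couplingMatrix S.w).map Complex.ofReal)
        (S.sub.A.map Complex.ofReal) ((S.sub.B * S.sub.C).map Complex.ofReal) l) t)
      (Set.Ici 0) t := by
  have h := (hx t ht).1
  rw [Pi.zero_apply, Matrix.mulVec_zero, add_zero, hasDerivWithinAt_pi] at h
  rw [observe_adjointDynamics]
  exact HasDerivWithinAt.fun_sum fun p _ => ((h p).ofReal_comp).const_mul _

end PHNetwork

theorem mainTheorem1 {N n m q p : ℕ} (S : PHNetwork.NetworkedSystem N n m q p)
    (hmin : PHNetwork.IsMinimalRealization S.sub.A S.sub.B S.sub.C)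
    (htree : (PHNetwork.underlyingGraph S.w).IsTree)
    (hroot : ∃ T : Digraph (Fin N), T ≤ PHNetwork.couplingDigraph S.w ∧
      PHNetwork.IsDirectedRootedSpanningTree T)
    (x : ℝ → Fin N × Fin n → ℝ) (y : ℝ → Fin p × Fin m → ℝ)
    (hx : S.IsTrajectory 0 x y) (i j : Fin N) :
    Filter.Tendsto (fun t : ℝ => (fun k : Fin n => x t (i, k) - x t (j, k))) Filter.atTop (𝓝 0) := by
  open PHNetwork in
  obtain ⟨T, hTle, hT⟩ := hroot
  obtain ⟨r, hrT⟩ := hT.exists_root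
  have hr : ∀ v, Relation.ReflTransGen (couplingDigraph S.w).Adj r v := fun v =>
    Relation.ReflTransGen.mono (fun _ _ hab => hTle hab) _ _ (hrT v)
  rw [tendsto_pi_nhds]
  intro k
  set D := adjointDynamics ((couplingMatrix S.w).map Complex.ofReal)
    (S.sub.A.map Complex.ofReal) ((S.sub.B * S.sub.C).map Complex.ofReal)
  have hD : ∀ l ∈ disagreement N n, D l ∈ disagreement N n :=
    adjointDynamics_mem_disagreement (couplingMatrix_map_mulVec_one S.w) _ _
  -- The functional reading off the `k`-th coordinate of `x_i - x_j`.
  let l : Matrix (Fin N) (Fin n) ℂ := Matrix.single i k 1 - Matrix.single j k 1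
  have hl : l ∈ disagreement N n := by
    rw [mem_disagreement]
    funext c
    simp [l, Matrix.vecMul, dotProduct, Matrix.single_apply, Finset.sum_sub_distrib, ite_and]
  have hlim := tendsto_zero_of_eigenvalues_re_neg (D.restrict hD) (fun ν hν => by
      obtain ⟨v, hv⟩ := hν.exists_hasEigenvector
      refine re_neg_of_adjointDynamics_eq_smul S.sub (fun r μ => hmin.eq_zero_of_vecMul)
        S.w_nonneg hr v.2 (fun h => hv.2 (Subtype.ext h)) ?_
      exact congrArg Subtype.val hv.apply_eq_smul)
    (observe x ∘ₗ (disagreement N n).subtype)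
    (fun v t ht => hx.hasDerivWithinAt_observe v.1 t ht) ⟨l, hl⟩
  have hre := (Complex.continuous_re.tendsto 0).comp hlim
  refine hre.congr fun t => ?_
  simp [observe_apply, l, Matrix.single_apply, Fintype.sum_prod_type, ite_and]
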